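/- Let $M$ be a compact connected (Hausdorff, topological) surface without boundary with a finite cellular subdivision: a finite simple unoriented graph is embedded in $M$ (vertices are points, edges are self-avoiding continuous curves joining them, different edges meet only at vertices), cutting $M$ along the edges leaves finitely many two-dimensional cells, each the interior of a closed disc whose boundary circle is mapped along a closed walk of edges, and every edge belongs to exactly two different cells, once to each. Let $V$ be the set of vertices and $E$ the set of oriented edges ($(x,y)$ and $(y,x)$ for every edge $\{x,y\}$), and let $F$ be the set of oriented cells; $f^c$ is the cell $f$ with the opposite orientation. For $f\in F$ let $C_f$ be the corresponding oriented boundary cycle; write $(x,y)\in f$ if $(x,y)$ is traversed by $C_f$. Assume that $M$ is non-orientable: it is not possible to choose one orientation for every cell so that no $(x,y)\in E$ belongs to two of the chosen oriented cells. Let $\Lambda^2$ be the space of the maps $\psi:F\to\mathbb R$ with $\psi(f^c)=-\psi(f)$, and put $d\psi(x,y)=\sum_{f\in F:\,(x,y)\in f}\psi(f)$ for $(x,y)\in E$. The elementary cycles are $C_{\{x,y\}}=(x,y,x)$ for every edge $\{x,y\}$ and $C_f$ for every $f\in F$; cycles are considered up to rotation, and $\mathcal C^e$ is the set of the classes $[C]$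 of elementary cycles. Let $r^{[C]}$ be the function on $E$ that is $1$ on the oriented edges of $C$ and $0$ elsewhere. A weight $r:E\to[0,\infty)$ has an elementary decomposition if $r=\sum_{[C]\in\mathcal C^e}\rho([C])\,r^{[C]}$ for some $\rho:\mathcal C^e\to[0,\infty)$. Let $r:E\to[0,\infty)$ be a weight such that $\phi^r(x,y):=r(x,y)-r(y,x)$ belongs to $d\Lambda^2=\{d\psi:\psi\in\Lambda^2\}$. Then there is exactly one $\psi\in\Lambda^2$ with $d\psi=\phi^r$. Choose arbitrarily one orientation for every cell, which gives $F'\subset F$, and one orientation for every edge, which gives $E'\subset E$. For $(x,y)\in E'$ let $f_1,f_2\in F'$ be the chosen orientations of the two cells to which the edge belongs. If $f_1,f_2$ induce opposite orientations on the edge (one contains $(x,y)$, the other $(y,x)$), let $$J(x,y)=\big[\min\{\psi(f_1),\psi(f_2)\},\max\{\psi(f_1),\psi(f_2)\}\big];$$ if they induce the same orientation on it (both contain $(x,y)$ or both contain $(y,x)$), let $$J(x,y)=\big(-\infty,\min\{\psi(f_1),\psi(f_2)\}\big]\cup\big[\max\{\psi(f_1),\psi(f_2)\},+\infty\big).$$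 Let $s(x,y)=r(x,y)-[\phi^r(x,y)]_+$ be the symmetric part of $r$, where $[a]_+=\max\{a,0\}$. Then $r$ has an elementary decomposition if and only if $$s(x,y)\ge d(0,J(x,y))\qquad\text{for every }(x,y)\in E',$$ where $d(0,J)=\inf_{t\in J}|t|$. -/

import Mathlib

open Set

/-- A finite cellular subdivision of a surface `M`. An unoriented graph is embedded in `M`:
vertices are points and edges are self-avoiding curves, two of which can meet only at vertices.
Cutting `M` along the edges leaves the open two-dimensional cells, indexed by `F`. Each cell is
given with its characteristic map, from the closed unit disc of `ℂ`, whose restriction to the unit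
circle runs through the edges of a closed edge walk, the boundary of the cell. Every edge belongs
to exactly two different cells, once to each. `V` and `F` are finite wherever this is used. -/
structure CellularSubdivision (M V F : Type*) [TopologicalSpace M] where
  /-- The unoriented graph. Its darts are the oriented edges `(x, y)`. -/
  graph : SimpleGraph V
  /-- The position of a vertex in `M`. -/
  point : V → M
  /-- The curve along an oriented edge, from its first to its second vertex. -/
  arc : graph.Dart → unitInterval → M
  /-- A vertex at which the boundary walk of a cell starts. -/
  base : F → V
  /-- The boundary walk of a cell, in one of its two directions. -/
  bdry : ∀ f, graph.Walk (base f) (base f)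
  /-- The characteristic map of a cell; only its values on the closed unit disc matter. -/
  cell : F → ℂ → M
  point_injective : Function.Injective point
  arc_continuous : ∀ d, Continuous (arc d)
  arc_injective : ∀ d, Function.Injective (arc d)
  arc_zero : ∀ d, arc d 0 = point d.fst
  arc_symm : ∀ d t, arc d.symm t = arc d (unitInterval.symm t)
  arc_vertex : ∀ d t, arc d t ∈ range point → t = 0 ∨ t = 1
  arc_inter : ∀ d d', d.edge ≠ d'.edge → range (arc d) ∩ range (arc d') ⊆ range point
  cell_continuousOn : ∀ f, ContinuousOn (cell f) (Metric.closedBall 0 1)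
  cell_injOn : ∀ f, InjOn (cell f) (Metric.ball 0 1)
  cell_disjoint : ∀ f g, f ≠ g →
    Disjoint (cell f '' Metric.ball 0 1) (cell g '' Metric.ball 0 1)
  /-- The open cells are what is left of `M` after cutting along the embedded graph. -/
  cell_cover : (⋃ f, cell f '' Metric.ball 0 1) = (range point ∪ ⋃ d, range (arc d))ᶜ
  /-- The boundary walk is not trivial and uses no edge twice. -/
  bdry_isCircuit : ∀ f, (bdry f).IsCircuit
  /-- The unit circle is mapped along the boundary walk: the `k`-th of its `n` equal arcs is
  mapped along the `k`-th oriented edge. -/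
  cell_circle : ∀ f (k : Fin (bdry f).darts.length) (t : unitInterval),
    cell f (Complex.exp (2 * Real.pi * Complex.I *
      (((k : ℕ) : ℂ) + ((t : ℝ) : ℂ)) / (((bdry f).darts.length : ℕ) : ℂ))) =
        arc ((bdry f).darts.get k) t
  /-- Every edge belongs to exactly two different cells. -/
  edge_two_cells : ∀ d : graph.Dart, {f | d.edge ∈ (bdry f).edges}.ncard = 2

/-- `CycleMem c x y`: the oriented edge `(x, y)` belongs to the cycle class `c` (a finite sequence
of vertices up to rotation), that is, some representative of `c` begins with `x, y`. -/
def CycleMem {V : Type*} (c : Cycle V) (x y : V) : Prop :=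
  ∃ l : List V, c = ((x :: y :: l : List V) : Cycle V)

open Classical in
/-- The weight of a cycle class: `1` on the oriented edges that belong to it and `0` elsewhere. -/
noncomputable def cycleWeight {V : Type*} {G : SimpleGraph V} (c : Cycle V) (e : G.Dart) : ℝ :=
  if CycleMem c e.fst e.snd then 1 else 0

/-- The discrete vector field `φ^r(x,y) = r(x,y) - r(y,x)` of a weight `r`. -/
def weightField {V : Type*} {G : SimpleGraph V} (r : G.Dart → ℝ) (e : G.Dart) : ℝ :=
  r e - r e.symm

/-- The weight `r^φ(x,y) = [φ(x,y)]_+` of a discrete vector field `φ`. -/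
def fieldWeight {V : Type*} {G : SimpleGraph V} (φ : G.Dart → ℝ) (e : G.Dart) : ℝ :=
  max (φ e) 0

/-- The symmetric part `s = r - r^{φ^r}` of a weight `r`. -/
def symmPart {V : Type*} {G : SimpleGraph V} (r : G.Dart → ℝ) (e : G.Dart) : ℝ :=
  r e - fieldWeight (weightField r) e

/-- `E'` contains exactly one of the two orientations of every edge. -/
def IsEdgeChoice {V : Type*} {G : SimpleGraph V} (E' : Set G.Dart) : Prop :=
  ∀ e : G.Dart, Xor (e ∈ E') (e.symm ∈ E')

/-- The polyhedron `P'(J)` of the vectors `s` with `s_i ≥ d(0, J_i)` for all `i`. -/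
noncomputable def polyhedron' {ι : Type*} (J : ι → Set ℝ) : Set (ι → ℝ) :=
  {s | ∀ i, Metric.infDist 0 (J i) ≤ s i}

/-- Two-chains. Oriented cells are pairs in `F × Bool`, where the Boolean tells the two
orientations of a cell apart; a two-chain changes sign when the orientation is reversed. -/
def twoChains (F : Type*) : Submodule ℝ (F × Bool → ℝ) where
  carrier := {ψ | ∀ f b, ψ (f, b) = -ψ (f, !b)}
  add_mem' := by
    intro ψ χ h k f b
    simp only [Pi.add_apply, h f b, k f b, neg_add]
  zero_mem' := by
    intro f b
    simp
  smul_mem' := by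
    intro c ψ h f b
    simp only [Pi.smul_apply, h f b, smul_neg]

namespace CellularSubdivision

variable {M V F : Type*} [TopologicalSpace M] (K : CellularSubdivision M V F)

/-- The elementary cycle `[C_f]` of an oriented cell: the vertices of the boundary walk, in the
order given by the orientation. -/
def faceCycle (f : F × Bool) : Cycle V :=
  if f.2 then (((K.bdry f.1).darts.map (fun e => e.fst) : List V) : Cycle V)
  else (((K.bdry f.1).darts.map (fun e => e.fst) : List V) : Cycle V).reverse

/-- `(x, y) ∈ f` for an oriented edge `e = (x, y)` and an oriented cell `f`. -/
def EdgeMem (e : K.graph.Dart) (f : F × Bool) : Prop :=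
  CycleMem (K.faceCycle f) e.fst e.snd

/-- The surface is orientable: the cells can be oriented in such a way that all pairs of adjacent
cells are oriented in agreement, that is, no oriented edge belongs to two of the chosen oriented
cells. (This is the classical definition for a surface that is given with a cellular subdivision.)
-/
def Orientable : Prop :=
  ∃ o : F → Bool, ∀ f g, f ≠ g → ∀ e : K.graph.Dart,
    ¬ (K.EdgeMem e (f, o f) ∧ K.EdgeMem e (g, o g))

open Classical in
/-- The boundary operator: `dψ(x,y)` is the sum of `ψ(f)` over the oriented cells `f` to which
`(x, y)` belongs. -/
noncomputable def boundary [Fintype F] (ψ : F × Bool → ℝ) (e : K.graph.Dart) : ℝ :=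
  ∑ f : F × Bool with K.EdgeMem e f, ψ f

/-- The set `dΛ²` of the discrete vector fields `dψ`, for two-chains `ψ`. -/
def boundaries [Fintype F] : Set (K.graph.Dart → ℝ) :=
  K.boundary '' (twoChains F : Set (F × Bool → ℝ))

open Classical in
/-- The set `𝒞^e` of the classes of elementary cycles: the classes of `(x, y, x)` for all edges
and the classes `[C_f]` for all oriented cells. -/
noncomputable def elementaryCycles [Fintype V] [Fintype F] : Finset (Cycle V) :=
  Finset.univ.image (fun e : K.graph.Dart => (([e.fst, e.snd] : List V) : Cycle V)) ∪
    Finset.univ.image K.faceCycle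

/-- The set `R^e` of the weights that have an elementary decomposition. -/
def elementaryWeights [Fintype V] [Fintype F] : Set (K.graph.Dart → ℝ) :=
  {r | ∃ ρ : Cycle V → ℝ, (∀ c ∈ K.elementaryCycles, 0 ≤ ρ c) ∧
    ∀ e, r e = ∑ c ∈ K.elementaryCycles, ρ c * cycleWeight c e}

/-- The closed set `J(x,y)`, for a two-chain `ψ` and a choice `o` of an orientation for every cell.
The two cells `f`, `g` at the edge are determined up to their order. If the chosen orientations
induce opposite orientations on the edge, the set is the interval between `ψ(f)` and `ψ(g)`; if
they induce the same one, it is the complement of the open interval. -/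
def edgeSet' (o : F → Bool) (ψ : F × Bool → ℝ) (e : K.graph.Dart) : Set ℝ :=
  {t | ∃ f g : F, f ≠ g ∧
    ((K.EdgeMem e (f, o f) ∧ K.EdgeMem e.symm (g, o g) ∧
        t ∈ Icc (min (ψ (f, o f)) (ψ (g, o g))) (max (ψ (f, o f)) (ψ (g, o g)))) ∨
      ((K.EdgeMem e (f, o f) ∧ K.EdgeMem e (g, o g) ∨
          K.EdgeMem e.symm (f, o f) ∧ K.EdgeMem e.symm (g, o g)) ∧
        t ∈ Iic (min (ψ (f, o f)) (ψ (g, o g))) ∪ Ici (max (ψ (f, o f)) (ψ (g, o g)))))}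

end CellularSubdivision

/-! Write `d` for the boundary operator and `ψ₊` for the positive part of `ψ`. If `dψ = 0`, the two
values of `ψ` at an edge cancel, so `|ψ|` is the same on adjacent cells. The surface is strongly
connected (`eq_univ_of_forall_adjacent_mem`), so a nonzero `ψ` vanishes nowhere, and its signs would
orient all cells coherently. Hence `d` is injective on two-chains of a non-orientable surface, which
gives the uniqueness of `ψ`.

In an elementary decomposition the edge cycles do not contribute to `φ^r`. By injectivity the face
coefficients `σ` therefore satisfy `σ(f) - σ(f^c) = ψ(f)`, so that `σ ≥ ψ₊` and `r ≥ d(ψ₊)`.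
Conversely, `r` and `d(ψ₊)` have the same antisymmetric part, so if `r ≥ d(ψ₊)` then the difference
is a nonnegative symmetric weight, carried by the edge cycles. This is `mem_elementaryWeights_iff`.

Finally, `d(ψ₊) - [dψ]₊` is at each edge exactly the distance from `0` to `J` (`infDist_edgeSet'`),
so subtracting `[φ^r]₊` turns `r ≥ d(ψ₊)` into the stated bound on `s`. -/

/-! ### Cycle classes of closed walks. -/

theorem CycleMem.reverse {V : Type*} {c : Cycle V} {x y : V} (h : CycleMem c x y) :
    CycleMem c.reverse y x := by
  obtain ⟨l, rfl⟩ := h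
  refine ⟨l.reverse, ?_⟩
  rw [Cycle.reverse_coe, Cycle.coe_eq_coe]
  simpa using List.isRotated_append (l := l.reverse) (l' := [y, x])

theorem cycleMem_reverse_iff {V : Type*} {c : Cycle V} {x y : V} :
    CycleMem c.reverse x y ↔ CycleMem c y x :=
  ⟨fun h => by simpa using h.reverse, fun h => h.reverse⟩

namespace SimpleGraph.Walk

variable {V : Type*} {G : SimpleGraph V} {v : V}

theorem cycle_chain_darts (w : G.Walk v v) : (w.darts : Cycle G.Dart).Chain G.DartAdj := by
  cases w with
  | nil => simp
  | cons h p =>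
    rw [darts_cons, Cycle.chain_coe_cons]
    -- Repeating the first edge at the end turns cyclic adjacency into adjacency along a walk.
    simpa using isChain_dartAdj_darts ((cons h p).append (cons h nil))

/-- Consecutive vertices of the cycle determine the dart between them, since each dart ends where
the cyclically next one starts. This replaces membership in a rotation class by membership in a
list. -/
theorem cycleMem_map_fst_darts_iff (w : G.Walk v v) (hw : 2 ≤ w.length) (e : G.Dart) :
    CycleMem ((w.darts.map (fun d => d.fst) : List V) : Cycle V) e.fst e.snd ↔ e ∈ w.darts := by
  have hc := w.cycle_chain_darts
  constructor
  · rintro ⟨l, hl⟩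
    obtain ⟨n, hn⟩ := Cycle.coe_eq_coe.1 hl
    rw [← List.map_rotate] at hn
    have hr : w.darts.rotate n ~r w.darts := (List.IsRotated.forall w.darts n)
    rw [← Cycle.coe_eq_coe.2 hr] at hc
    rw [← hr.mem_iff]
    match hD : w.darts.rotate n, hn, hc with
    | [], hn, _ => simp at hn
    | [a], hn, _ => simp at hn
    | a :: b :: D, hn, hc =>
      rw [Cycle.chain_coe_cons] at hc
      simp only [List.map_cons, List.cons.injEq] at hn
      have hab : a.snd = b.fst := by
        have := hc
        simp only [List.cons_append, List.isChain_cons_cons] at this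
        exact this.1
      have : e = a := SimpleGraph.Dart.ext _ _ (Prod.ext hn.1.symm (by
        rw [hab, hn.2.1]))
      simp [this]
  · intro he
    obtain ⟨s, t, hst⟩ := List.append_of_mem he
    have hr : w.darts ~r (e :: t ++ s) := by
      rw [hst]; exact List.isRotated_append
    have hl : w.darts.length = w.length := w.length_darts
    rw [Cycle.coe_eq_coe.2 hr] at hc
    have hlen := hr.perm.length_eq
    rw [List.cons_append] at hr hc hlen
    match hD : t ++ s, hr, hc with
    | [], _, _ => simp [hD] at hlen; omega
    | b :: D, hr, hc =>
      rw [Cycle.chain_coe_cons] at hc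
      simp only [List.cons_append, List.isChain_cons_cons] at hc
      refine ⟨D.map (fun d => d.fst), ?_⟩
      rw [Cycle.coe_eq_coe]
      have h1 : e.snd = b.fst := hc.1
      rw [h1]
      exact hr.map (fun d : G.Dart => d.fst)

end SimpleGraph.Walk

/-! ### Incidence of oriented edges and oriented cells. -/

namespace CellularSubdivision

variable {M V F : Type*} [TopologicalSpace M] (K : CellularSubdivision M V F)

theorem edgeMem_true_iff (e : K.graph.Dart) (f : F) :
    K.EdgeMem e (f, true) ↔ e ∈ (K.bdry f).darts := by
  have := (K.bdry_isCircuit f).three_le_length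
  simpa [EdgeMem, faceCycle] using
    (K.bdry f).cycleMem_map_fst_darts_iff (by omega) e

theorem edgeMem_not_iff (e : K.graph.Dart) (f : F) (b : Bool) :
    K.EdgeMem e (f, !b) ↔ K.EdgeMem e.symm (f, b) := by
  have h : K.faceCycle (f, false) = (K.faceCycle (f, true)).reverse := rfl
  cases b
  · rw [EdgeMem, EdgeMem, h, cycleMem_reverse_iff]; rfl
  · rw [EdgeMem, EdgeMem, Bool.not_true, h, cycleMem_reverse_iff]; rfl

theorem mem_edges_iff (e : K.graph.Dart) (f : F) :
    e.edge ∈ (K.bdry f).edges ↔ ∃ b, K.EdgeMem e (f, b) := by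
  have h : K.EdgeMem e (f, false) ↔ e.symm ∈ (K.bdry f).darts := by
    rw [← K.edgeMem_true_iff, ← K.edgeMem_not_iff, Bool.not_true]
  rw [Bool.exists_bool, h, K.edgeMem_true_iff, SimpleGraph.Walk.edges, List.mem_map]
  constructor
  · rintro ⟨d, hd, hde⟩
    rcases (SimpleGraph.dart_edge_eq_iff _ _).1 hde with rfl | rfl
    · exact Or.inr hd
    · exact Or.inl hd
  · rintro (h | h)
    · exact ⟨_, h, SimpleGraph.Dart.edge_symm e⟩
    · exact ⟨_, h, rfl⟩

/-- A boundary circuit is a trail, so it cannot run through an edge in both directions. -/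
theorem edgeMem_unique {e : K.graph.Dart} {f : F} {b c : Bool} (hb : K.EdgeMem e (f, b))
    (hc : K.EdgeMem e (f, c)) : b = c := by
  have key : ¬ (K.EdgeMem e (f, true) ∧ K.EdgeMem e (f, false)) := by
    rintro ⟨h1, h2⟩
    rw [← Bool.not_true, K.edgeMem_not_iff, K.edgeMem_true_iff] at h2
    rw [K.edgeMem_true_iff] at h1
    exact e.symm_ne (List.inj_on_of_nodup_map (K.bdry_isCircuit f).isTrail.edges_nodup h2 h1
      (SimpleGraph.Dart.edge_symm e))
  cases b <;> cases c <;> tauto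

theorem exists_two_cells (e : K.graph.Dart) : ∃ f g a b, f ≠ g ∧
    ∀ h : F × Bool, K.EdgeMem e h ↔ h = (f, a) ∨ h = (g, b) := by
  obtain ⟨f, g, hfg, h⟩ := Set.ncard_eq_two.1 (K.edge_two_cells e)
  have h' : ∀ k, e.edge ∈ (K.bdry k).edges ↔ k = f ∨ k = g := fun k => by
    have := Set.ext_iff.1 h k
    simpa using this
  obtain ⟨a, ha⟩ := (K.mem_edges_iff e f).1 ((h' f).2 (Or.inl rfl))
  obtain ⟨b, hb⟩ := (K.mem_edges_iff e g).1 ((h' g).2 (Or.inr rfl))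
  refine ⟨f, g, a, b, hfg, fun ⟨k, c⟩ => ⟨fun hk => ?_, ?_⟩⟩
  · rcases (h' k).1 ((K.mem_edges_iff e k).2 ⟨c, hk⟩) with rfl | rfl
    · exact Or.inl (by rw [K.edgeMem_unique hk ha])
    · exact Or.inr (by rw [K.edgeMem_unique hk hb])
  · rintro (h | h) <;> rw [h] <;> assumption

end CellularSubdivision

/-! ### Local topology of the surface and arcs of the circle. -/

open Topology in
/-- In a surface, every point has arbitrarily small neighbourhoods whose complement of the point is
nonempty and connected. -/
theorem exists_nhds_isPreconnected_diff_singleton {M : Type*} [TopologicalSpace M]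
    [ChartedSpace (EuclideanSpace ℝ (Fin 2)) M] (x : M) {U : Set M} (hU : U ∈ 𝓝 x) :
    ∃ W ∈ 𝓝 x, W ⊆ U ∧ (W \ {x}).Nonempty ∧ IsPreconnected (W \ {x}) := by
  set φ := chartAt (EuclideanSpace ℝ (Fin 2)) x
  have hx : x ∈ φ.source := mem_chart_source _ x
  have hfx : φ x ∈ φ.target := φ.map_source hx
  have h1 : φ.target ∩ φ.symm ⁻¹' U ∈ 𝓝 (φ x) := by
    refine Filter.inter_mem (φ.open_target.mem_nhds hfx) ?_
    refine (φ.symm.continuousAt hfx).preimage_mem_nhds ?_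
    rwa [φ.left_inv hx]
  obtain ⟨ε, hε, hb⟩ := Metric.mem_nhds_iff.1 h1
  -- The neighbourhood is parametrized by the whole plane, so that its punctured version is an
  -- injective image of the punctured plane.
  set B := OpenPartialHomeomorph.univBall (φ x) ε
  have hBs : B.source = univ := OpenPartialHomeomorph.univBall_source _ _
  have hBt : B.target = Metric.ball (φ x) ε := OpenPartialHomeomorph.univBall_target _ hε
  have hB0 : B 0 = φ x := OpenPartialHomeomorph.univBall_apply_zero _ _
  have hmaps : ∀ y, B y ∈ Metric.ball (φ x) ε := fun y => hBt ▸ B.map_source (hBs ▸ mem_univ y)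
  have hcont : Continuous (fun y => φ.symm (B y)) := by
    refine φ.symm.continuousOn.comp_continuous
      (OpenPartialHomeomorph.continuous_univBall _ _) fun y => ?_
    exact (hb (hmaps y)).1
  have hinj : Function.Injective (fun y => φ.symm (B y)) := by
    intro y z hyz
    have := φ.symm.injOn (hb (hmaps y)).1 (hb (hmaps z)).1 hyz
    exact B.injOn (hBs ▸ mem_univ y) (hBs ▸ mem_univ z) this
  have h0 : φ.symm (B 0) = x := by rw [hB0, φ.left_inv hx]
  have hdiff : range (fun y => φ.symm (B y)) \ {x} = (fun y => φ.symm (B y)) '' {0}ᶜ := by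
    rw [← h0, ← image_univ, compl_eq_univ_sdiff, image_sdiff hinj, image_singleton]
  have hconn : IsConnected ({0}ᶜ : Set (EuclideanSpace ℝ (Fin 2))) :=
    isConnected_compl_singleton_of_one_lt_rank
      (Module.one_lt_rank_of_one_lt_finrank (by simp)) 0
  refine ⟨range (fun y => φ.symm (B y)), ?_, ?_, ?_, ?_⟩
  · have : range (fun y => φ.symm (B y)) = φ.symm '' Metric.ball (φ x) ε := by
      rw [← hBt, ← B.image_source_eq_target, hBs, image_univ, ← range_comp]; rfl
    rw [this]
    have := φ.symm.image_mem_nhds hfx (Metric.ball_mem_nhds _ hε)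
    rwa [φ.left_inv hx] at this
  · rintro _ ⟨y, rfl⟩
    exact (hb (hmaps y)).2
  · rw [hdiff]; exact hconn.nonempty.image _
  · rw [hdiff]; exact hconn.isPreconnected.image _ hcont.continuousOn

/-- Every point of the unit circle lies on one of `n` equal arcs. -/
theorem exists_circle_arc {z : ℂ} (hz : ‖z‖ = 1) {n : ℕ} (hn : 0 < n) :
    ∃ (k : Fin n) (t : unitInterval), z = Complex.exp (2 * Real.pi * Complex.I *
      (((k : ℕ) : ℂ) + ((t : ℝ) : ℂ)) / (n : ℂ)) := by
  set θ := toIcoMod Real.two_pi_pos 0 z.arg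
  have hθ : θ ∈ Ico 0 (0 + 2 * Real.pi) := toIcoMod_mem_Ico Real.two_pi_pos 0 z.arg
  rw [zero_add] at hθ
  have hn' : (0 : ℝ) < n := by exact_mod_cast hn
  have hzθ : z = Complex.exp (θ * Complex.I) := by
    have h1 : θ = z.arg - toIcoDiv Real.two_pi_pos 0 z.arg • (2 * Real.pi) := rfl
    have h2 : z = Complex.exp (z.arg * Complex.I) := by
      conv_lhs => rw [← Complex.norm_mul_exp_arg_mul_I z, hz]
      simp
    rw [h2, Complex.exp_eq_exp_iff_exists_int]
    refine ⟨toIcoDiv Real.two_pi_pos 0 z.arg, ?_⟩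
    rw [h1]
    push_cast [zsmul_eq_mul]
    ring
  set u := θ * n / (2 * Real.pi)
  have hu0 : 0 ≤ u := by have := hθ.1; positivity
  have hun : u < n := by
    rw [div_lt_iff₀ Real.two_pi_pos, mul_comm (n : ℝ)]
    exact mul_lt_mul_of_pos_right hθ.2 hn'
  -- The arc is the integer part of `nθ/2π`; the position on it is the fractional part.
  refine ⟨⟨⌊u⌋₊, (Nat.floor_lt hu0).2 hun⟩, ⟨u - ⌊u⌋₊, ?_, ?_⟩, ?_⟩
  · exact sub_nonneg.2 (Nat.floor_le hu0)
  · have := Nat.lt_floor_add_one u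
    linarith
  · rw [hzθ]
    congr 1
    have hθu : θ = 2 * Real.pi * u / n := by
      simp only [u]; field_simp
    conv_lhs => rw [hθu]
    push_cast
    ring

/-! ### Closed cells and strong connectedness. -/

namespace CellularSubdivision

variable {M V F : Type*} [TopologicalSpace M] (K : CellularSubdivision M V F)

/-- The closed cell: the image of the closed unit disc. -/
def closedCell (f : F) : Set M := K.cell f '' Metric.closedBall 0 1

theorem isClosed_closedCell [T2Space M] (f : F) : IsClosed (K.closedCell f) :=
  ((isCompact_closedBall 0 1).image_of_continuousOn (K.cell_continuousOn f)).isClosed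

/-- Ensures that every neighbourhood of a vertex of a closed cell contains points of the open cell.
-/
theorem closedCell_subset_closure (f : F) :
    K.closedCell f ⊆ closure (K.cell f '' Metric.ball 0 1) := by
  have h := K.cell_continuousOn f
  rw [← closure_ball (0 : ℂ) one_ne_zero] at h
  rw [closedCell, ← closure_ball (0 : ℂ) one_ne_zero]
  exact h.image_closure

theorem mem_closedCell {f : F} {x : M} (hx : x ∈ K.closedCell f) :
    x ∈ K.cell f '' Metric.ball 0 1 ∨ ∃ d ∈ (K.bdry f).darts, x ∈ range (K.arc d) := by
  obtain ⟨z, hz, rfl⟩ := hx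
  rcases (mem_closedBall_zero_iff.1 hz).lt_or_eq with h | h
  · exact Or.inl ⟨z, mem_ball_zero_iff.2 h, rfl⟩
  · have := (K.bdry_isCircuit f).three_le_length
    obtain ⟨k, t, rfl⟩ := exists_circle_arc h (n := (K.bdry f).darts.length)
      (by rw [SimpleGraph.Walk.length_darts]; omega)
    exact Or.inr ⟨_, List.get_mem _ k, t, (K.cell_circle f k t).symm⟩

theorem range_arc_symm (d : K.graph.Dart) : range (K.arc d.symm) = range (K.arc d) := by
  have : K.arc d.symm = K.arc d ∘ unitInterval.symm := funext (K.arc_symm d)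
  rw [this, unitInterval.symm_involutive.surjective.range_comp]

theorem range_arc_eq_of_edge_eq {d d' : K.graph.Dart} (h : d.edge = d'.edge) :
    range (K.arc d) = range (K.arc d') := by
  rcases (SimpleGraph.dart_edge_eq_iff _ _).1 h with rfl | rfl
  · rfl
  · exact K.range_arc_symm d'

theorem range_arc_subset_closedCell {d : K.graph.Dart} {f : F}
    (h : d.edge ∈ (K.bdry f).edges) : range (K.arc d) ⊆ K.closedCell f := by
  obtain ⟨d', hd', he⟩ := List.mem_map.1 h
  rw [← K.range_arc_eq_of_edge_eq he]
  obtain ⟨k, rfl⟩ := List.get_of_mem hd'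
  rintro _ ⟨t, rfl⟩
  refine ⟨_, ?_, K.cell_circle f k t⟩
  rw [mem_closedBall_zero_iff]
  refine le_of_eq ?_
  have : (2 * Real.pi * Complex.I * (((k : ℕ) : ℂ) + ((t : ℝ) : ℂ)) /
      (((K.bdry f).darts.length : ℕ) : ℂ)) =
      ((2 * Real.pi * ((k : ℕ) + (t : ℝ)) / ((K.bdry f).darts.length : ℕ) : ℝ) : ℂ) *
        Complex.I := by
    push_cast; ring
  rw [this, Complex.norm_exp_ofReal_mul_I]

theorem notMem_of_mem_openCell {f : F} {x : M} (hx : x ∈ K.cell f '' Metric.ball 0 1) :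
    x ∉ range K.point ∧ ∀ d, x ∉ range (K.arc d) := by
  have : x ∈ (range K.point ∪ ⋃ d, range (K.arc d))ᶜ := by
    rw [← K.cell_cover]; exact mem_iUnion.2 ⟨f, hx⟩
  simp only [mem_compl_iff, mem_union, not_or] at this
  exact ⟨this.1, fun d hd => this.2 (mem_iUnion.2 ⟨d, hd⟩)⟩

theorem exists_mem_closedCell {x : M} (hx : x ∉ range K.point) : ∃ f, x ∈ K.closedCell f := by
  by_cases h : ∃ d, x ∈ range (K.arc d)
  · obtain ⟨d, hd⟩ := h
    obtain ⟨f, _, _, _, _, hf⟩ := K.exists_two_cells d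
    exact ⟨f, K.range_arc_subset_closedCell ((K.mem_edges_iff d f).2 ⟨_, (hf _).2 (Or.inl rfl)⟩) hd⟩
  · have : x ∈ ⋃ f, K.cell f '' Metric.ball 0 1 := by
      rw [K.cell_cover]
      simpa using ⟨by simpa using hx, by simpa using h⟩
    obtain ⟨f, hf⟩ := mem_iUnion.1 this
    exact ⟨f, image_mono Metric.ball_subset_closedBall hf⟩

/-- Open cells are disjoint from each other and from the graph, and different edges meet only at
vertices. -/
theorem exists_common_edge {f g : F} (hfg : f ≠ g) {x : M} (hf : x ∈ K.closedCell f)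
    (hg : x ∈ K.closedCell g) (hx : x ∉ range K.point) :
    ∃ e : K.graph.Dart, e.edge ∈ (K.bdry f).edges ∧ e.edge ∈ (K.bdry g).edges := by
  rcases K.mem_closedCell hf with h1 | ⟨d, hd, h1⟩ <;>
  rcases K.mem_closedCell hg with h2 | ⟨d', hd', h2⟩
  · exact absurd h2 (disjoint_left.1 (K.cell_disjoint f g hfg) h1)
  · exact absurd h2 ((K.notMem_of_mem_openCell h1).2 d')
  · exact absurd h1 ((K.notMem_of_mem_openCell h2).2 d)
  · by_cases he : d.edge = d'.edge
    · exact ⟨d, List.mem_map_of_mem hd, he ▸ List.mem_map_of_mem hd'⟩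
    · exact absurd (K.arc_inter d d' he ⟨h1, h2⟩) hx

open Topology in
/-- A surface is strongly connected: any two cells are joined by a chain of cells in which
consecutive ones share an edge. -/
theorem eq_univ_of_forall_adjacent_mem [T2Space M] [ConnectedSpace M]
    [ChartedSpace (EuclideanSpace ℝ (Fin 2)) M] [Finite V] [Finite F] {A : Set F}
    (hA : A.Nonempty)
    (h : ∀ f ∈ A, ∀ g, ∀ e : K.graph.Dart, e.edge ∈ (K.bdry f).edges →
      e.edge ∈ (K.bdry g).edges → g ∈ A) : A = univ := by
  by_contra hne
  obtain ⟨g₀, hg₀⟩ := (ne_univ_iff_exists_notMem A).1 hne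
  set S : Set M := range K.point
  have hS : S.Finite := finite_range K.point
  -- If `A` were proper, `X A` and `X Aᶜ` would be nonempty closed sets that cover `M` and meet only
  -- at vertices.
  let X : Set F → Set M := fun B => ⋃ f ∈ B, K.closedCell f
  have hclosed : ∀ B, IsClosed (X B) := fun B =>
    B.toFinite.isClosed_biUnion fun f _ => K.isClosed_closedCell f
  have hnonempty : ∀ B : Set F, B.Nonempty → (X B).Nonempty := fun B ⟨f, hf⟩ =>
    ⟨K.cell f 0, mem_biUnion hf ⟨0, by simp, rfl⟩⟩
  have hinter : X A ∩ X Aᶜ ⊆ S := by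
    rintro x ⟨hx1, hx2⟩
    obtain ⟨f, hf, hxf⟩ := mem_iUnion₂.1 hx1
    obtain ⟨g, hg, hxg⟩ := mem_iUnion₂.1 hx2
    by_contra hx
    obtain ⟨e, he1, he2⟩ := K.exists_common_edge (by rintro rfl; exact hg hf) hxf hxg hx
    exact hg (h f hf g e he1 he2)
  have hcover : ∀ x ∉ S, x ∈ X A ∪ X Aᶜ := by
    intro x hx
    obtain ⟨f, hf⟩ := K.exists_mem_closedCell hx
    by_cases hfA : f ∈ A
    · exact Or.inl (mem_biUnion hfA hf)
    · exact Or.inr (mem_biUnion hfA hf)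
  have hnhds : ∀ v : M, (S \ {v})ᶜ ∈ 𝓝 v := fun v =>
    (hS.subset sdiff_subset).isClosed.isOpen_compl.mem_nhds (by simp)
  -- Even a vertex is covered: it is a limit of points that are not vertices.
  have huniv : X A ∪ X Aᶜ = univ := by
    refine eq_univ_of_forall fun x => ?_
    rw [← ((hclosed A).union (hclosed Aᶜ)).closure_eq, mem_closure_iff_nhds]
    intro U hU
    obtain ⟨W, -, hWU, ⟨y, hy, hyx⟩, -⟩ :=
      exists_nhds_isPreconnected_diff_singleton x (Filter.inter_mem hU (hnhds x))
    exact ⟨y, (hWU hy).1, hcover y fun hyS => (hWU hy).2 ⟨hyS, hyx⟩⟩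
  obtain ⟨v, -, hv1, hv2⟩ := isPreconnected_closed_iff.1 isPreconnected_univ (X A) (X Aᶜ)
    (hclosed A) (hclosed Aᶜ) huniv.ge (by simpa using hnonempty A hA)
    (by simpa using hnonempty Aᶜ ⟨g₀, hg₀⟩)
  -- `v` is a common vertex of the two sets. A connected punctured neighbourhood without vertices
  -- meets both sets, hence contains another common point, which would have to be a vertex.
  obtain ⟨W, hW, hWU, -, hconn⟩ := exists_nhds_isPreconnected_diff_singleton v (hnhds v)
  have hmeet : ∀ B : Set F, v ∈ X B → ((W \ {v}) ∩ X B).Nonempty := by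
    intro B hv
    obtain ⟨f, hf, hvf⟩ := mem_iUnion₂.1 hv
    obtain ⟨y, hyW, hy⟩ := mem_closure_iff_nhds.1 (K.closedCell_subset_closure f hvf) W hW
    refine ⟨y, ⟨hyW, ?_⟩, mem_biUnion hf (image_mono Metric.ball_subset_closedBall hy)⟩
    rintro rfl
    exact (K.notMem_of_mem_openCell hy).1 (hinter ⟨hv1, hv2⟩)
  obtain ⟨y, ⟨hyW, hyv⟩, hy⟩ := isPreconnected_closed_iff.1 hconn (X A) (X Aᶜ)
    (hclosed A) (hclosed Aᶜ) (by simp [huniv]) (hmeet A hv1) (hmeet Aᶜ hv2)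
  exact hWU hyW ⟨hinter hy, hyv⟩

end CellularSubdivision

/-! ### Explicit distances from `0`. -/

section Distance

theorem infDist_zero_eq {J : Set ℝ} {m : ℝ} (h : ∃ t ∈ J, |t| = m) (h' : ∀ t ∈ J, m ≤ |t|) :
    Metric.infDist 0 J = m := by
  obtain ⟨t, ht, rfl⟩ := h
  refine le_antisymm ?_ ((Metric.le_infDist ⟨t, ht⟩).2 fun {y} hy => ?_)
  · simpa [Real.dist_eq] using Metric.infDist_le_dist_of_mem (x := (0 : ℝ)) ht
  · simpa [Real.dist_eq] using h' y hy

/-- The right side is `d(ψ₊) - [dψ]₊` at an edge where the oriented cells have values `p` and `-q`.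
The witness is the point of the interval nearest to `0`. -/
theorem infDist_zero_Icc (p q : ℝ) : Metric.infDist 0 (Icc (min p q) (max p q)) =
    max p 0 + max (-q) 0 - max (p - q) 0 := by
  refine infDist_zero_eq ⟨if 0 ≤ p then max 0 (min p q) else min 0 (max p q), ?_, ?_⟩ ?_
  · simp only [mem_Icc]; grind
  · grind
  · simp only [mem_Icc]; grind

theorem infDist_zero_Iic_union_Ici (p q : ℝ) :
    Metric.infDist 0 (Iic (min p q) ∪ Ici (max p q)) =
      max p 0 + max q 0 - max (p + q) 0 := by
  -- The sign of `p + q` decides which end of the gap is closer to `0`, when `0` lies in the gap.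
  refine infDist_zero_eq ⟨if 0 ≤ p + q then min 0 (min p q) else max 0 (max p q), ?_, ?_⟩ ?_
  · simp only [mem_union, mem_Iic, mem_Ici]; grind
  · grind
  · simp only [mem_union, mem_Iic, mem_Ici]; grind

end Distance

/-! ### Cycles of edges. -/

section EdgeCycle

variable {V : Type*} {G : SimpleGraph V}

/-- The cycle `(x, y, x)` of an edge. -/
def edgeCycle (e : G.Dart) : Cycle V := (([e.fst, e.snd] : List V) : Cycle V)

theorem edgeCycle_symm (e : G.Dart) : edgeCycle e.symm = edgeCycle e :=
  Cycle.coe_eq_coe.2 (List.isRotated_append (l := [e.snd]) (l' := [e.fst]))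

theorem cycleMem_edgeCycle_iff {d e : G.Dart} :
    CycleMem (edgeCycle d) e.fst e.snd ↔ edgeCycle d = edgeCycle e := by
  refine ⟨fun ⟨l, hl⟩ => ?_, fun h => ⟨[], h⟩⟩
  have hlen := congrArg Cycle.length hl
  have : l = [] := by simpa [edgeCycle] using hlen.symm
  rw [hl, this]; rfl

theorem edgeCycle_eq_iff {d e : G.Dart} :
    edgeCycle d = edgeCycle e ↔ d = e ∨ d = e.symm := by
  constructor
  · intro h
    have h' := congrArg Cycle.toMultiset h
    rw [edgeCycle, edgeCycle, Cycle.coe_toMultiset, Cycle.coe_toMultiset] at h'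
    rw [← SimpleGraph.dart_edge_eq_iff]
    have hp : [d.fst, d.snd].Perm [e.fst, e.snd] := Multiset.coe_eq_coe.1 h'
    change s(d.fst, d.snd) = s(e.fst, e.snd)
    rw [Sym2.eq_iff]
    have h1 : d.fst ∈ [e.fst, e.snd] := hp.subset (by simp)
    have h2 : d.snd ∈ [e.fst, e.snd] := hp.subset (by simp)
    have h3 : d.fst ≠ d.snd := d.fst_ne_snd
    simp only [List.mem_cons, List.not_mem_nil, or_false] at h1 h2
    grind
  · rintro (rfl | rfl)
    · rfl
    · exact edgeCycle_symm e

end EdgeCycle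

/-! ### The boundary operator at an edge. -/

namespace CellularSubdivision

variable {M V F : Type*} [TopologicalSpace M] (K : CellularSubdivision M V F)

variable {K} in
theorem edgeMem_iff_of_ne {e : K.graph.Dart} {f g : F} {a b : Bool} (hf : K.EdgeMem e (f, a))
    (hg : K.EdgeMem e (g, b)) (hfg : f ≠ g) (h : F × Bool) :
    K.EdgeMem e h ↔ h = (f, a) ∨ h = (g, b) := by
  obtain ⟨f', g', a', b', hne, H⟩ := K.exists_two_cells e
  have h1 := (H _).1 hf
  have h2 := (H _).1 hg
  rw [H]
  grind

variable {K} in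
theorem boundary_apply [Fintype F] {e : K.graph.Dart} {f g : F} {a b : Bool}
    (hf : K.EdgeMem e (f, a)) (hg : K.EdgeMem e (g, b)) (hfg : f ≠ g) (ψ : F × Bool → ℝ) :
    K.boundary ψ e = ψ (f, a) + ψ (g, b) := by
  classical
  rw [boundary, ← Finset.sum_pair (show (f, a) ≠ (g, b) by simp [hfg])]
  refine Finset.sum_congr ?_ fun _ _ => rfl
  ext h
  simp [edgeMem_iff_of_ne hf hg hfg h]

theorem exists_edgeMem (e : K.graph.Dart) :
    ∃ f g a b, f ≠ g ∧ K.EdgeMem e (f, a) ∧ K.EdgeMem e (g, b) := by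
  obtain ⟨f, g, a, b, hne, H⟩ := K.exists_two_cells e
  exact ⟨f, g, a, b, hne, (H _).2 (Or.inl rfl), (H _).2 (Or.inr rfl)⟩

variable {K} in
theorem EdgeMem.symm {e : K.graph.Dart} {f : F} {a : Bool} (h : K.EdgeMem e (f, a)) :
    K.EdgeMem e.symm (f, !a) := by
  rwa [edgeMem_not_iff, SimpleGraph.Dart.symm_symm]

theorem boundary_symm [Fintype F] (ψ : F × Bool → ℝ) (e : K.graph.Dart) :
    K.boundary ψ e.symm = K.boundary (fun h => ψ (h.1, !h.2)) e := by
  obtain ⟨f, g, a, b, hne, hf, hg⟩ := K.exists_edgeMem e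
  rw [boundary_apply hf hg hne, boundary_apply hf.symm hg.symm hne]

theorem boundary_sub [Fintype F] (ψ χ : F × Bool → ℝ) :
    K.boundary (ψ - χ) = K.boundary ψ - K.boundary χ := by
  ext e
  simp [boundary]

theorem boundary_mono [Fintype F] {ψ χ : F × Bool → ℝ} (h : ψ ≤ χ) :
    K.boundary ψ ≤ K.boundary χ :=
  fun _ => Finset.sum_le_sum fun i _ => h i

/-- An edge cycle has length 2, a circuit in a simple graph at least 3. -/
theorem edgeCycle_ne_faceCycle (e : K.graph.Dart) (h : F × Bool) :
    edgeCycle e ≠ K.faceCycle h := by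
  intro heq
  have := congrArg Cycle.length heq
  have h3 := (K.bdry_isCircuit h.1).three_le_length
  have : 2 = (K.bdry h.1).length := by
    rcases h with ⟨f, _ | _⟩ <;> simpa [edgeCycle, faceCycle] using this
  omega

/-- The weight carried by the positive part of a two-chain `ψ` has the discrete vector field `dψ`. -/
theorem boundary_posPart_sub [Fintype F] {ψ : F × Bool → ℝ} (hψ : ψ ∈ twoChains F)
    (e : K.graph.Dart) : K.boundary (fun h => max (ψ h) 0) e -
      K.boundary (fun h => max (ψ h) 0) e.symm = K.boundary ψ e := by
  rw [boundary_symm, ← Pi.sub_apply, ← boundary_sub]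
  congr 2
  ext ⟨f, b⟩
  have : ψ (f, b) = -ψ (f, !b) := hψ f b
  simp only [Pi.sub_apply]
  grind

/-! ### Injectivity and elementary decompositions. -/

section Surface

variable [T2Space M] [ConnectedSpace M] [ChartedSpace (EuclideanSpace ℝ (Fin 2)) M] [Finite V]

/-- On a non-orientable surface the boundary operator is injective on two-chains. -/
theorem eq_zero_of_boundary_eq_zero [Fintype F] (hK : ¬ K.Orientable) {ψ : F × Bool → ℝ}
    (hψ : ψ ∈ twoChains F) (h : K.boundary ψ = 0) : ψ = 0 := by
  by_contra hne
  obtain ⟨⟨f₀, b₀⟩, h₀⟩ := Function.ne_iff.1 hne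
  have hneg : ∀ f b, ψ (f, b) = -ψ (f, !b) := hψ
  have hiff : ∀ f b, ψ (f, b) ≠ 0 ↔ ψ (f, true) ≠ 0 := by
    rintro f (_ | _)
    · rw [hneg f false, Bool.not_false, neg_ne_zero]
    · rfl
  have huniv : {f | ψ (f, true) ≠ 0} = univ := by
    refine K.eq_univ_of_forall_adjacent_mem ⟨f₀, (hiff f₀ b₀).1 h₀⟩ fun f hf g e hef heg => ?_
    by_cases hfg : f = g
    · exact hfg ▸ hf
    obtain ⟨a, ha⟩ := (K.mem_edges_iff e f).1 hef
    obtain ⟨b, hb⟩ := (K.mem_edges_iff e g).1 heg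
    have := boundary_apply ha hb hfg ψ
    rw [h, Pi.zero_apply] at this
    refine (hiff g b).1 fun hg => (hiff f a).2 hf ?_
    linarith
  -- Orient each cell so that `ψ` is positive; a dart shared by two cells would then have positive
  -- boundary value.
  refine hK ⟨fun f => decide (0 < ψ (f, true)), fun f g hfg e he => ?_⟩
  have hpos : ∀ f, 0 < ψ (f, decide (0 < ψ (f, true))) := by
    intro f
    have hf : ψ (f, true) ≠ 0 := huniv.ge (mem_univ f)
    by_cases hp : 0 < ψ (f, true)
    · simp [hp]
    · have := hneg f false
      have hlt := lt_of_le_of_ne (not_lt.1 hp) hf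
      simp only [hp, decide_false, this, Bool.not_false]
      linarith
  have := boundary_apply he.1 he.2 hfg ψ
  rw [h, Pi.zero_apply] at this
  linarith [hpos f, hpos g]

theorem eq_of_boundary_eq [Fintype F] (hK : ¬ K.Orientable) {ψ χ : F × Bool → ℝ}
    (hψ : ψ ∈ twoChains F) (hχ : χ ∈ twoChains F) (h : K.boundary ψ = K.boundary χ) : ψ = χ :=
  sub_eq_zero.1 <| K.eq_zero_of_boundary_eq_zero hK ((twoChains F).sub_mem hψ hχ)
    (by rw [boundary_sub, h, sub_self])

/-- On a non-orientable surface, different oriented cells have different boundary cycles. -/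
theorem faceCycle_injective [Finite F] (hK : ¬ K.Orientable) :
    Function.Injective K.faceCycle := by
  rintro ⟨f, a⟩ ⟨g, b⟩ h
  have hiff : ∀ e, K.EdgeMem e (f, a) ↔ K.EdgeMem e (g, b) := fun e => by
    rw [EdgeMem, EdgeMem, h]
  have hnot : ∀ e, K.EdgeMem e (f, !a) ↔ K.EdgeMem e (g, !b) := fun e => by
    rw [edgeMem_not_iff, edgeMem_not_iff, hiff]
  by_cases hfg : f = g
  · subst hfg
    have := (K.bdry_isCircuit f).three_le_length
    rw [← SimpleGraph.Walk.length_darts] at this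
    obtain ⟨d, hd⟩ := List.exists_mem_of_length_pos (by omega : 0 < (K.bdry f).darts.length)
    rw [← K.edgeMem_true_iff] at hd
    have h1 := hiff d
    have h2 := hnot d
    by_contra hab
    have hab' : a ≠ b := fun h => hab (by rw [h])
    have hboth : K.EdgeMem d (f, false) := by
      cases a <;> cases b <;> simp_all
    exact absurd (K.edgeMem_unique hd hboth) (by simp)
  · exfalso
    classical
    have hedge : ∀ e : K.graph.Dart, (∃ c, K.EdgeMem e (f, c)) → ∀ k,
        (∃ c, K.EdgeMem e (k, c)) → k = f ∨ k = g := by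
      rintro e ⟨c, hc⟩ k ⟨c', hc'⟩
      have : ∃ c', K.EdgeMem e (g, c') := by
        by_cases hca : c = a
        · exact ⟨b, (hiff e).1 (hca ▸ hc)⟩
        · rw [Bool.eq_not.2 hca] at hc
          exact ⟨!b, (hnot e).1 hc⟩
      obtain ⟨c'', hg⟩ := this
      rcases (edgeMem_iff_of_ne hc hg hfg _).1 hc' with h | h
      · exact Or.inl (congrArg Prod.fst h)
      · exact Or.inr (congrArg Prod.fst h)
    have hedge' : ∀ e : K.graph.Dart, (∃ c, K.EdgeMem e (g, c)) → ∃ c, K.EdgeMem e (f, c) := by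
      rintro e ⟨c, hc⟩
      by_cases hcb : c = b
      · exact ⟨a, (hiff e).2 (hcb ▸ hc)⟩
      · rw [Bool.eq_not.2 hcb] at hc
        exact ⟨!a, (hnot e).2 hc⟩
    -- Two cells with the same boundary use up both sides of all their edges, so they are the whole
    -- surface; reversing one of them then gives a coherent orientation.
    have huniv : ({f, g} : Set F) = univ := by
      refine K.eq_univ_of_forall_adjacent_mem ⟨f, by simp⟩ fun k hk l e hek hel => ?_
      rw [mem_edges_iff] at hek hel
      rcases hk with rfl | rfl
      · exact hedge e hek l hel
      · exact hedge e (hedge' e hek) l hel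
    have hcases : ∀ k, k = f ∨ k = g := fun k => huniv.ge (mem_univ k)
    have hcontra : ∀ e, ¬ (K.EdgeMem e (f, a) ∧ K.EdgeMem e (g, !b)) := by
      rintro e ⟨h1, h2⟩
      exact absurd (K.edgeMem_unique ((hiff e).1 h1) h2) (by simp)
    refine hK ⟨fun k => if k = f then a else !b, fun k l hkl e he => ?_⟩
    rcases hcases k with rfl | rfl <;> rcases hcases l with rfl | rfl
    · exact hkl rfl
    · exact hcontra e (by simpa [Ne.symm hfg] using he)
    · exact hcontra e (by simpa [Ne.symm hfg, and_comm] using he)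
    · exact hkl rfl

/-- `elementaryCycles` is a set of classes, so summing over oriented cells needs
`faceCycle_injective`, and separating the two kinds of cycles needs `edgeCycle_ne_faceCycle`. -/
theorem sum_elementaryCycles [Fintype F] [Fintype V] (hK : ¬ K.Orientable) (ρ : Cycle V → ℝ)
    (e : K.graph.Dart) :
    ∑ c ∈ K.elementaryCycles, ρ c * cycleWeight c e =
      ρ (edgeCycle e) + K.boundary (fun h => ρ (K.faceCycle h)) e := by
  classical
  rw [elementaryCycles, Finset.sum_union, Finset.sum_image (g := K.faceCycle)
    (K.faceCycle_injective hK).injOn]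
  · congr 1
    · rw [Finset.sum_eq_single (edgeCycle e)]
      · rw [cycleWeight, if_pos (cycleMem_edgeCycle_iff.2 rfl), mul_one]
      · intro c hc hne
        obtain ⟨d, -, rfl⟩ := Finset.mem_image.1 hc
        change edgeCycle d ≠ edgeCycle e at hne
        change ρ (edgeCycle d) * cycleWeight (edgeCycle d) e = 0
        rw [cycleWeight, if_neg (fun h => hne (cycleMem_edgeCycle_iff.1 h)), mul_zero]
      · exact fun h => absurd (Finset.mem_image_of_mem _ (Finset.mem_univ e)) h
    · rw [boundary, Finset.sum_filter]
      refine Finset.sum_congr rfl fun h _ => ?_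
      simp only [cycleWeight, EdgeMem, mul_ite, mul_one, mul_zero]
      congr
  · rw [Finset.disjoint_left]
    intro c hc hc'
    obtain ⟨d, -, rfl⟩ := Finset.mem_image.1 hc
    obtain ⟨h, -, hh⟩ := Finset.mem_image.1 hc'
    exact K.edgeCycle_ne_faceCycle d h hh.symm

/-- A weight whose discrete vector field is the boundary of `ψ` has an elementary decomposition if
and only if it dominates the weight carried by the positive part of `ψ`. -/
theorem mem_elementaryWeights_iff [Fintype F] [Fintype V] (hK : ¬ K.Orientable)
    {r : K.graph.Dart → ℝ} {ψ : F × Bool → ℝ} (hψ : ψ ∈ twoChains F)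
    (hr : K.boundary ψ = weightField r) :
    r ∈ K.elementaryWeights ↔ K.boundary (fun h => max (ψ h) 0) ≤ r := by
  classical
  constructor
  · rintro ⟨ρ, hρ, hsum⟩
    simp only [K.sum_elementaryCycles hK] at hsum
    set σ : F × Bool → ℝ := fun h => ρ (K.faceCycle h)
    have hσ : ∀ h, 0 ≤ σ h := fun h =>
      hρ _ (Finset.mem_union_right _ (Finset.mem_image_of_mem _ (Finset.mem_univ h)))
    have hedge : ∀ e : K.graph.Dart, 0 ≤ ρ (edgeCycle e) := fun e =>
      hρ _ (Finset.mem_union_left _ (Finset.mem_image_of_mem _ (Finset.mem_univ e)))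
    -- The antisymmetrized face coefficients form a two-chain with boundary `φ^r`, as the edge
    -- cycles cancel.
    have hψσ : ψ = σ - fun h => σ (h.1, !h.2) := by
      refine K.eq_of_boundary_eq hK hψ (fun f b => by simp) ?_
      ext e
      rw [hr, boundary_sub, Pi.sub_apply, ← K.boundary_symm, weightField, hsum, hsum,
        edgeCycle_symm]
      ring
    intro e
    rw [hsum e]
    have : K.boundary (fun h => max (ψ h) 0) e ≤ K.boundary σ e := by
      refine K.boundary_mono (fun h => max_le ?_ (hσ h)) e
      rw [hψσ]
      simpa using hσ (h.1, !h.2)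
    linarith [hedge e]
  · intro h
    set τ : K.graph.Dart → ℝ := fun e => r e - K.boundary (fun h => max (ψ h) 0) e
    have hτ : ∀ e, τ e.symm = τ e := by
      intro e
      have h1 : r e - r e.symm = K.boundary ψ e := (congrFun hr e).symm
      have h2 := K.boundary_posPart_sub hψ e
      simp only [τ]
      linarith
    have hfac : Function.FactorsThrough τ (edgeCycle : K.graph.Dart → Cycle V) := by
      intro d e hde
      rcases edgeCycle_eq_iff.1 hde with rfl | rfl
      · rfl
      · exact hτ e
    -- Face cycles receive `ψ₊` and edge cycles the remainder `τ`, which is well defined on them by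
    -- symmetry; the default `0` is never used.
    refine ⟨Function.extend K.faceCycle (fun h => max (ψ h) 0) (Function.extend edgeCycle τ 0),
      fun c hc => ?_, fun e => ?_⟩
    · rcases Finset.mem_union.1 hc with hc | hc
      · obtain ⟨e, -, rfl⟩ := Finset.mem_image.1 hc
        change 0 ≤ Function.extend _ _ _ (edgeCycle e)
        rw [Function.extend_apply' _ _ _ fun ⟨h, hh⟩ => K.edgeCycle_ne_faceCycle e h hh.symm,
          hfac.extend_apply]
        exact sub_nonneg.2 (h e)
      · obtain ⟨k, -, rfl⟩ := Finset.mem_image.1 hc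
        rw [(K.faceCycle_injective hK).extend_apply]
        exact le_max_right _ _
    · rw [K.sum_elementaryCycles hK,
        Function.extend_apply' _ _ _ fun ⟨h, hh⟩ => K.edgeCycle_ne_faceCycle e h hh.symm,
        hfac.extend_apply]
      simp only [(K.faceCycle_injective hK).extend_apply, τ]
      ring

end Surface

/-! ### The set `J` and its distance from `0`. -/

section EdgeSet

variable {K} {e : K.graph.Dart} {f g : F} (o : F → Bool) (ψ : F × Bool → ℝ)

theorem edgeSet'_of_opposite (hfg : f ≠ g) (hf : K.EdgeMem e (f, o f))
    (hg : K.EdgeMem e (g, !o g)) : K.edgeSet' o ψ e =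
      Icc (min (ψ (f, o f)) (ψ (g, o g))) (max (ψ (f, o f)) (ψ (g, o g))) := by
  have H := edgeMem_iff_of_ne hf hg hfg
  have H' : ∀ h c, K.EdgeMem e.symm (h, c) ↔ (h, !c) = (f, o f) ∨ (h, !c) = (g, !o g) :=
    fun h c => by rw [← edgeMem_not_iff, H]
  ext t
  simp only [edgeSet', H, H', Prod.mk.injEq]
  constructor
  · rintro ⟨h, k, hhk, h1⟩
    grind
  · intro ht
    exact ⟨f, g, hfg, Or.inl ⟨by simp, by simp, ht⟩⟩

theorem edgeSet'_of_same (hfg : f ≠ g)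
    (h : K.EdgeMem e (f, o f) ∧ K.EdgeMem e (g, o g) ∨
      K.EdgeMem e (f, !o f) ∧ K.EdgeMem e (g, !o g)) : K.edgeSet' o ψ e =
      Iic (min (ψ (f, o f)) (ψ (g, o g))) ∪ Ici (max (ψ (f, o f)) (ψ (g, o g))) := by
  ext t
  rcases h with ⟨hf, hg⟩ | ⟨hf, hg⟩
  · have H := edgeMem_iff_of_ne hf hg hfg
    have H' : ∀ h c, K.EdgeMem e.symm (h, c) ↔ (h, !c) = (f, o f) ∨ (h, !c) = (g, o g) :=
      fun h c => by rw [← edgeMem_not_iff, H]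
    simp only [edgeSet', H, H', Prod.mk.injEq]
    constructor
    · rintro ⟨h, k, hhk, h1⟩
      grind
    · intro ht
      exact ⟨f, g, hfg, Or.inr ⟨by simp, ht⟩⟩
  · have H := edgeMem_iff_of_ne hf hg hfg
    have H' : ∀ h c, K.EdgeMem e.symm (h, c) ↔ (h, !c) = (f, !o f) ∨ (h, !c) = (g, !o g) :=
      fun h c => by rw [← edgeMem_not_iff, H]
    simp only [edgeSet', H, H', Prod.mk.injEq]
    constructor
    · rintro ⟨h, k, hhk, h1⟩
      grind
    · intro ht
      exact ⟨f, g, hfg, Or.inr ⟨by simp, ht⟩⟩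

variable {ψ}

/-- The right side does not involve `o`; the cases compare the chosen orientations of the two cells
with those that contain `e`. -/
theorem infDist_edgeSet' [Fintype F] (hψ : ψ ∈ twoChains F) (e : K.graph.Dart) :
    Metric.infDist 0 (K.edgeSet' o ψ e) =
      K.boundary (fun h => max (ψ h) 0) e - max (K.boundary ψ e) 0 := by
  obtain ⟨f, g, a, b, hne, hf, hg⟩ := K.exists_edgeMem e
  have hneg : ∀ f b, ψ (f, !b) = -ψ (f, b) := fun f b => by rw [hψ f b, neg_neg]
  rw [boundary_apply hf hg hne, boundary_apply hf hg hne]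
  by_cases ha : a = o f <;> by_cases hb : b = o g
  · subst ha hb
    rw [edgeSet'_of_same o ψ hne (Or.inl ⟨hf, hg⟩), infDist_zero_Iic_union_Ici]
  · rw [Bool.eq_not.2 hb] at hg ⊢
    subst ha
    rw [edgeSet'_of_opposite o ψ hne hf hg, infDist_zero_Icc, hneg, sub_eq_add_neg (ψ _)]
  · rw [Bool.eq_not.2 ha] at hf ⊢
    subst hb
    rw [edgeSet'_of_opposite o ψ hne.symm hg hf, infDist_zero_Icc, hneg]
    ring_nf
  · rw [Bool.eq_not.2 ha] at hf ⊢
    rw [Bool.eq_not.2 hb] at hg ⊢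
    rw [edgeSet'_of_same o ψ hne (Or.inr ⟨hf, hg⟩), infDist_zero_Iic_union_Ici, hneg, hneg]
    -- Since `a₊ - (-a)₊ = a`, the expression `p₊ + q₊ - (p + q)₊` is unchanged under `(p, q) ↦ (-p,
    -- -q)`.
    grind

end EdgeSet

end CellularSubdivision
-- The main theorem.
theorem theorem2p7 {M V F : Type*} [TopologicalSpace M] [T2Space M] [CompactSpace M]
    [ConnectedSpace M] [ChartedSpace (EuclideanSpace ℝ (Fin 2)) M] [Fintype V] [Fintype F]
    (K : CellularSubdivision M V F) (hK : ¬ K.Orientable)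
    (o : F → Bool) (E' : Set K.graph.Dart) (hE' : IsEdgeChoice E')
    (r : K.graph.Dart → ℝ) (hr : ∀ e, 0 ≤ r e) (hφ : weightField r ∈ K.boundaries) :
    (∃! ψ : F × Bool → ℝ, ψ ∈ twoChains F ∧ K.boundary ψ = weightField r) ∧
    ∀ ψ ∈ twoChains F, K.boundary ψ = weightField r →
      (r ∈ K.elementaryWeights ↔
        (fun e : E' => symmPart r e) ∈ polyhedron' (fun e : E' => K.edgeSet' o ψ e)) := by
  constructor
  · obtain ⟨ψ, hψ, h⟩ := hφ
    exact ⟨ψ, ⟨hψ, h⟩, fun χ hχ => K.eq_of_boundary_eq hK hχ.1 hψ (hχ.2.trans h.symm)⟩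
  · intro ψ hψ h
    rw [K.mem_elementaryWeights_iff hK hψ h]
    have hiff : ∀ e, Metric.infDist 0 (K.edgeSet' o ψ e) ≤ symmPart r e ↔
        K.boundary (fun h => max (ψ h) 0) e ≤ r e := by
      intro e
      rw [CellularSubdivision.infDist_edgeSet' o hψ, h, symmPart, fieldWeight, sub_le_sub_iff_right]
    -- Both sides have the same antisymmetric part, so the inequality passes to the reversed edge
    -- and testing it on `E'` suffices.
    have hsymm : ∀ e : K.graph.Dart, K.boundary (fun h => max (ψ h) 0) e ≤ r e →
        K.boundary (fun h => max (ψ h) 0) e.symm ≤ r e.symm := by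
      intro e he
      have h1 : K.boundary ψ e = r e - r e.symm := congrFun h e
      have h2 := K.boundary_posPart_sub hψ e
      linarith
    constructor
    · exact fun hle e => (hiff e).2 (hle e)
    · intro hle e
      rcases hE' e with he | he
      · exact (hiff e).1 (hle ⟨e, he.1⟩)
      · simpa using hsymm _ ((hiff _).1 (hle ⟨e.symm, he.1⟩))
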